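/- All Lie groups and vector spaces are real, smooth and finite-dimensional. For a Lie group $G$ with Lie algebra $\mathfrak g=T_1G$ and a left-invariant Riemannian metric $g_R$ on $G$, let $r(p)=d_R(1,p)$ be the Riemannian distance from the identity, i.e. the infimum of the lengths of curves from $1$ to $p$ (with $r(p)=\infty$ if $p$ is not in the identity component). $G$ is said to have (at most) linear growth if there exist a left-invariant Riemannian metric $g_R$ on $G$, a Euclidean scalar product on $\mathfrak g$ with norm $\Vert\cdot\Vert$, and constants $a,b\ge 0$ such that $$\frac{\Vert u\Vert}{a+b\,r(p)}\le \Vert \mathrm{Ad}_p(u)\Vert\le (a+b\,r(p))\,\Vert u\Vert$$ for every $p\in G$ and every $u\in\mathfrak g$ (arithmetic in $[0,\infty]$). A Lie group is called pseudo-compact if it is isomorphic, as a Lie group, to the direct product of a compact Lie group and a vector space. **Proposition.** Let $K$ be a pseudo-compact Lie group, $V$ a vector space, and $\rho:K\to \mathrm{GL}(V)$ a (smooth) representation such that $\rho(K)$ is pre-compact in $\mathrm{GL}(V)$, i.e. has compact closure in $\mathrm{GL}(V)$. Let $G=K\ltimes_\rho V$ be the semidirect product, that is, the manifold $K\times V$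 with the group law $(k_1,v_1)(k_2,v_2)=(k_1k_2,\,v_1+\rho(k_1)v_2)$. Then $G$ has linear growth. -/

import Mathlib

open scoped Manifold ContDiff Bundle NNReal ENNReal

noncomputable section

section LinearGrowth

variable {E : Type*} [NormedAddCommGroup E] [NormedSpace ℝ E]
  {H : Type*} [TopologicalSpace H] (I : ModelWithCorners ℝ E H)
  (G : Type*) [TopologicalSpace G] [ChartedSpace H G] [Group G]

/-- The adjoint map `Ad_p : 𝔤 → 𝔤` of a Lie group, i.e. the differential at `1` of the conjugation
`q ↦ p * q * p⁻¹`, where `𝔤 = T₁G`. The differential takes values in the tangent space at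
`p * 1 * p⁻¹`, which is the tangent space at `1` since these two points are equal. -/
def lieAd {G : Type*} [TopologicalSpace G] [ChartedSpace H G] [Group G] (p : G) :
    GroupLieAlgebra I G →L[ℝ] GroupLieAlgebra I G :=
  (congrArg (fun q : G => (GroupLieAlgebra I G →L[ℝ] TangentSpace I q))
    (show p * 1 * p⁻¹ = 1 by group)).mp
    (mfderiv I I (fun q : G => p * q * p⁻¹) 1)

variable [LieGroup I ∞ G]

/-- Smooth Riemannian metrics on the manifold underlying a Lie group. -/
abbrev RiemannianMetricOn : Type _ :=
  Bundle.ContMDiffRiemannianMetric I ∞ E (fun x : G => TangentSpace I x)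

variable {I G}

/-- A Riemannian metric is left-invariant if every left translation is an isometry:
`g_{pq}(dL_p v, dL_p w) = g_q(v, w)`. -/
def RiemannianMetricOn.IsLeftInvariant (g : RiemannianMetricOn I G) : Prop :=
  ∀ (p q : G) (v w : TangentSpace I q),
    g.inner (p * q) (mfderiv I I (fun x : G => p * x) q v) (mfderiv I I (fun x : G => p * x) q w)
      = g.inner q v w

/-- The function `r(p) = d(1, p)`, where `d` is the distance of the Riemannian metric `g`, that is,
the infimum of the `g`-lengths of the `C¹` curves from `1` to `p`. The infimum of the empty set is
`∞`, so `r` is finite exactly on the identity component of `G`. -/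
def RiemannianMetricOn.distOne (g : RiemannianMetricOn I G) (p : G) : ℝ≥0∞ :=
  letI : Bundle.RiemannianBundle (fun x : G => TangentSpace I x) := ⟨g.toRiemannianMetric⟩
  Manifold.riemannianEDist I (1 : G) p

variable (I G)

/-- A Euclidean scalar product on the Lie algebra `𝔤 = T₁G`. -/
structure LieAlgebraScalarProduct (G : Type*) [TopologicalSpace G] [ChartedSpace H G]
    [Group G] where
  form : GroupLieAlgebra I G →ₗ[ℝ] GroupLieAlgebra I G →ₗ[ℝ] ℝ
  symm : ∀ u v, form u v = form v u
  pos : ∀ u, u ≠ 0 → 0 < form u u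

/-- The norm `‖u‖ = √⟨u, u⟩` of a scalar product on `𝔤`, as an extended nonnegative number. -/
def LieAlgebraScalarProduct.enorm {I : ModelWithCorners ℝ E H}
    {G : Type*} [TopologicalSpace G] [ChartedSpace H G] [Group G]
    (B : LieAlgebraScalarProduct I G) (u : GroupLieAlgebra I G) : ℝ≥0∞ :=
  ENNReal.ofReal (Real.sqrt (B.form u u))

/-- A Lie group has (at most) linear growth if for some left-invariant Riemannian metric `g`, some
Euclidean scalar product on the Lie algebra and some constants `a, b`,
`‖u‖ / (a + b r(p)) ≤ ‖Ad_p u‖ ≤ (a + b r(p)) ‖u‖` for all `p ∈ G` and `u ∈ 𝔤`,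
where `r(p) = d(1, p)`. -/
def HasLinearGrowth : Prop :=
  ∃ g : RiemannianMetricOn I G, g.IsLeftInvariant ∧
    ∃ (B : LieAlgebraScalarProduct I G) (a b : ℝ≥0),
      ∀ (p : G) (u : GroupLieAlgebra I G),
        B.enorm u / (a + b * g.distOne p) ≤ B.enorm (lieAd I p u) ∧
        B.enorm (lieAd I p u) ≤ (a + b * g.distOne p) * B.enorm u

end LinearGrowth

section PseudoCompact

universe u

/-- A Lie group is pseudo-compact if it is (isomorphic, as a Lie group, to) the product of a compact
Lie group `C` and a finite-dimensional real vector space. As `C` is isomorphic to a subgroup of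
`K`, it is no restriction to take it in the universe of `K`. -/
def IsPseudoCompact {E : Type*} [NormedAddCommGroup E] [NormedSpace ℝ E]
    {H : Type*} [TopologicalSpace H] (I : ModelWithCorners ℝ E H)
    (K : Type u) [TopologicalSpace K] [ChartedSpace H K] [Group K] : Prop :=
  ∃ (m n : ℕ) (C : Type u) (_ : TopologicalSpace C)
    (_ : ChartedSpace (EuclideanSpace ℝ (Fin m)) C) (_ : Group C)
    (_ : LieGroup 𝓘(ℝ, EuclideanSpace ℝ (Fin m)) ∞ C) (_ : CompactSpace C)
    (e : Diffeomorph I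
      (𝓘(ℝ, EuclideanSpace ℝ (Fin m)).prod 𝓘(ℝ, EuclideanSpace ℝ (Fin n)))
      K (C × EuclideanSpace ℝ (Fin n)) ∞),
    ∀ x y : K, e (x * y) = ((e x).1 * (e y).1, (e x).2 + (e y).2)

end PseudoCompact

section Semidirect

variable {E : Type*} [NormedAddCommGroup E] [NormedSpace ℝ E]
  {H : Type*} [TopologicalSpace H] {I : ModelWithCorners ℝ E H}
  {K : Type*} [TopologicalSpace K] [ChartedSpace H K] [Group K]
  {V : Type*} [NormedAddCommGroup V] [NormedSpace ℝ V] [FiniteDimensional ℝ V]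

/-- The semidirect product `K ⋉_ρ V` of a Lie group `K` and a vector space `V` with respect to a
smooth representation `ρ : K → GL(V)`: the product manifold `K × V` with the multiplication
`(k₁, v₁) (k₂, v₂) = (k₁ k₂, v₁ + ρ(k₁) v₂)`. -/
def LieSemidirect
    (_ρ : ContMDiffMonoidMorphism I 𝓘(ℝ, V →L[ℝ] V) ∞ K (V →L[ℝ] V)ˣ) : Type _ := K × V

namespace LieSemidirect

variable (ρ : ContMDiffMonoidMorphism I 𝓘(ℝ, V →L[ℝ] V) ∞ K (V →L[ℝ] V)ˣ)

instance : TopologicalSpace (LieSemidirect ρ) := inferInstanceAs (TopologicalSpace (K × V))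

instance : ChartedSpace (ModelProd H V) (LieSemidirect ρ) :=
  inferInstanceAs (ChartedSpace (ModelProd H V) (K × V))

instance : Group (LieSemidirect ρ) where
  mul x y := (x.1 * y.1, x.2 + (ρ x.1 : V →L[ℝ] V) y.2)
  one := ((1 : K), (0 : V))
  inv x := (x.1⁻¹, -(ρ x.1⁻¹ : V →L[ℝ] V) x.2)
  mul_assoc x y z := by
    refine Prod.ext (mul_assoc x.1 y.1 z.1) ?_
    change (x.2 + (ρ x.1 : V →L[ℝ] V) y.2) + (ρ (x.1 * y.1) : V →L[ℝ] V) z.2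
      = x.2 + (ρ x.1 : V →L[ℝ] V) (y.2 + (ρ y.1 : V →L[ℝ] V) z.2)
    simp [map_mul, add_assoc]
  one_mul x := by
    refine Prod.ext (one_mul x.1) ?_
    change (0 : V) + (ρ (1 : K) : V →L[ℝ] V) x.2 = x.2
    simp [map_one]
  mul_one x := by
    refine Prod.ext (mul_one x.1) ?_
    change x.2 + (ρ x.1 : V →L[ℝ] V) (0 : V) = x.2
    simp
  inv_mul_cancel x := by
    refine Prod.ext (inv_mul_cancel x.1) ?_
    change -(ρ x.1⁻¹ : V →L[ℝ] V) x.2 + (ρ x.1⁻¹ : V →L[ℝ] V) x.2 = 0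
    simp

instance [LieGroup I ∞ K] : LieGroup (I.prod 𝓘(ℝ, V)) ∞ (LieSemidirect ρ) := by
  have hρ : ContMDiff I 𝓘(ℝ, V →L[ℝ] V) ∞ (fun k : K => (ρ k : V →L[ℝ] V)) :=
    Units.contMDiff_val.comp ρ.contMDiff_toFun
  have hM : IsManifold (I.prod 𝓘(ℝ, V)) ∞ (LieSemidirect ρ) :=
    inferInstanceAs (IsManifold (I.prod 𝓘(ℝ, V)) ∞ (K × V))
  have hmul : ContMDiff ((I.prod 𝓘(ℝ, V)).prod (I.prod 𝓘(ℝ, V))) (I.prod 𝓘(ℝ, V)) ∞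
      (fun p : (K × V) × (K × V) =>
        (p.1.1 * p.2.1, p.1.2 + (ρ p.1.1 : V →L[ℝ] V) p.2.2)) := by
    have h11 := (contMDiff_fst (I := I) (J := 𝓘(ℝ, V)) (n := ∞) (M := K) (N := V)).comp
      (contMDiff_fst (I := I.prod 𝓘(ℝ, V)) (J := I.prod 𝓘(ℝ, V)) (M := K × V) (N := K × V))
    have h12 := (contMDiff_snd (I := I) (J := 𝓘(ℝ, V)) (n := ∞) (M := K) (N := V)).comp
      (contMDiff_fst (I := I.prod 𝓘(ℝ, V)) (J := I.prod 𝓘(ℝ, V)) (M := K × V) (N := K × V))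
    have h21 := (contMDiff_fst (I := I) (J := 𝓘(ℝ, V)) (n := ∞) (M := K) (N := V)).comp
      (contMDiff_snd (I := I.prod 𝓘(ℝ, V)) (J := I.prod 𝓘(ℝ, V)) (M := K × V) (N := K × V))
    have h22 := (contMDiff_snd (I := I) (J := 𝓘(ℝ, V)) (n := ∞) (M := K) (N := V)).comp
      (contMDiff_snd (I := I.prod 𝓘(ℝ, V)) (J := I.prod 𝓘(ℝ, V)) (M := K × V) (N := K × V))
    exact (h11.mul h21).prodMk (h12.add ((hρ.comp h11).clm_apply h22))
  have hinv : ContMDiff (I.prod 𝓘(ℝ, V)) (I.prod 𝓘(ℝ, V)) ∞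
      (fun p : K × V => (p.1⁻¹, -(ρ p.1⁻¹ : V →L[ℝ] V) p.2)) := by
    have h1 := contMDiff_fst (I := I) (J := 𝓘(ℝ, V)) (n := ∞) (M := K) (N := V)
    have h2 := contMDiff_snd (I := I) (J := 𝓘(ℝ, V)) (n := ∞) (M := K) (N := V)
    exact h1.inv.prodMk ((hρ.comp h1.inv).clm_apply h2).neg
  exact { hM with contMDiff_mul := hmul, contMDiff_inv := hinv }

end LieSemidirect

end Semidirect

end

/-! Write `p = (k, v)`. Differentiating conjugation gives `Ad_p (X, w) = (Ad_k X, ρ(k) w - dρ(Ad_k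
X) v)` (`LieSemidirect.adjointCLM_apply`). Here `Ad_k` is bounded over `K`, since the vector factor
of `K` is central and the other factor is compact; `ρ(k)` is bounded by pre-compactness. Hence
`‖Ad_p‖` is at most affine in `‖v‖`. It remains to bound `‖v‖` by a multiple of `r(p)`. Left
translation by `p` acts on the `V`-component of tangent vectors by the bounded operator `ρ(k)`
(`LieSemidirect.snd_leftTrivialization`), so the projection `G → V` is Lipschitz for a
left-invariant metric (`enorm_sub_le_mul_distOne`). The lower bound on `Ad_p` is the upper bound for
`p⁻¹`, whose `V`-component `-ρ(k⁻¹) v` has norm at most a constant times `‖v‖`. -/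

noncomputable section

open Bundle Filter Topology MeasureTheory Set

/-! ### Left trivialization of the tangent bundle -/

section LeftTrivialization

variable {E : Type*} [NormedAddCommGroup E] [NormedSpace ℝ E]
  {H : Type*} [TopologicalSpace H] {I : ModelWithCorners ℝ E H}
  {G : Type*} [TopologicalSpace G] [ChartedSpace H G] [Group G]

variable (I) in
/-- The left trivialization `T_pG → 𝔤` of the tangent bundle of a Lie group (the Maurer-Cartan
form), that is, the differential at `p` of the left translation by `p⁻¹`. -/
def leftTrivialization (p : G) : E →L[ℝ] E :=
  mfderiv I I (fun x : G => p⁻¹ * x) p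

variable [LieGroup I ∞ G]

lemma mdifferentiable_mul_left' (p : G) : MDifferentiable I I (fun x : G => p * x) :=
  (contMDiff_mul_left (I := I) (n := ∞) (a := p)).mdifferentiable (by simp)

/-- Left translations are compatible with left trivializations. -/
lemma leftTrivialization_mul_mfderiv (p q : G) (v : TangentSpace I q) :
    leftTrivialization I (p * q) (mfderiv I I (fun x : G => p * x) q v)
      = leftTrivialization I q v := by
  have h : (fun x : G => q⁻¹ * x) = (fun x : G => (p * q)⁻¹ * x) ∘ (fun x : G => p * x) := by
    funext x; simp [mul_assoc]
  have h2 := mfderiv_comp (I := I) (I' := I) (I'' := I) q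
    (mdifferentiable_mul_left' (I := I) (p * q)⁻¹ (p * q)) (mdifferentiable_mul_left' p q)
  rw [← h] at h2
  exact (DFunLike.congr_fun h2 v).symm

/-- The differential of the left translation by `p` is a left inverse of the left
trivialization at `p`. -/
lemma mfderiv_mul_left_leftTrivialization (p : G) (v : E) :
    (mfderiv I I (fun x : G => p * x) (1 : G) : E →L[ℝ] E) (leftTrivialization I p v) = v := by
  have h : (fun x : G => x) = (fun x : G => p * x) ∘ (fun x : G => p⁻¹ * x) := by
    funext x; simp
  have h2 := mfderiv_comp (I := I) (I' := I) (I'' := I) p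
    (mdifferentiable_mul_left' (I := I) p (p⁻¹ * p)) (mdifferentiable_mul_left' p⁻¹ p)
  rw [← h] at h2
  have h3 := DFunLike.congr_fun h2 v
  have h4 : mfderiv I I (fun x : G => x) p = ContinuousLinearMap.id ℝ _ := mfderiv_id
  rw [h4] at h3
  have h5 : (mfderiv I I (fun x : G => p * x) (1 : G) : E →L[ℝ] E)
      = (mfderiv I I (fun x : G => p * x) (p⁻¹ * p) : E →L[ℝ] E) := by
    rw [inv_mul_cancel]
  rw [h5]
  exact h3.symm

lemma leftTrivialization_injective (p : G) : Function.Injective (leftTrivialization I p) :=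
  Function.LeftInverse.injective (mfderiv_mul_left_leftTrivialization p)

/-- The left trivialization depends smoothly on the base point. -/
lemma contMDiffAt_leftTrivialization (p₀ : G) :
    ContMDiffAt I 𝓘(ℝ, E →L[ℝ] E) ∞ (fun p : G => leftTrivialization I p ∘L
      (tangentBundleCore I G).coordChange (achart H p₀) (achart H p) p) p₀ := by
  have hf : ContMDiffAt (I.prod I) I ∞ (Function.uncurry fun p x : G => p⁻¹ * x)
      (p₀, id p₀) :=
    ((contMDiff_fst.inv).mul contMDiff_snd).contMDiffAt
  have h := ContMDiffAt.mfderiv (n := ∞) (m := ∞) (fun p x : G => p⁻¹ * x) id hf contMDiffAt_id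
    (by simp)
  -- The target point is always `1`, so the coordinate change on the target side is the identity.
  have h1 : (fun x : G => x⁻¹ * id x) = fun _ => 1 := by funext x; simp
  change ContMDiffAt I 𝓘(ℝ, E →L[ℝ] E) ∞
    (inTangentCoordinates I I id (fun x : G => x⁻¹ * id x) (fun p : G => leftTrivialization I p) p₀)
    p₀ at h
  rw [h1] at h
  refine h.congr_of_eventuallyEq ?_
  filter_upwards [chart_source_mem_nhds H p₀] with p hp
  refine Eq.trans ?_ (inTangentCoordinates_eq (I := I) (I' := I) id (fun _ : G => (1 : G))
    (fun p : G => leftTrivialization I p) hp (mem_chart_source H _)).symm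
  ext v
  exact ((tangentBundleCore I G).coordChange_self (achart H (1 : G)) 1 (mem_chart_source H _) _).symm

end LeftTrivialization

/-! ### Left-invariant Riemannian metrics -/

section Metric

variable {E : Type*} [NormedAddCommGroup E] [NormedSpace ℝ E]
  {F : Type*} [NormedAddCommGroup F] [InnerProductSpace ℝ F]
  {H : Type*} [TopologicalSpace H] {I : ModelWithCorners ℝ E H}
  {G : Type*} [TopologicalSpace G] [ChartedSpace H G] [Group G]

/-- The pull-back of the inner product of `F` by a linear map `A : E → F`, as a bilinear form. -/
def pullbackInner (A : E →L[ℝ] F) : E →L[ℝ] E →L[ℝ] ℝ :=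
  ((ContinuousLinearMap.compL ℝ E F ℝ).flip A) ∘L (innerSL ℝ ∘L A)

lemma contDiff_pullbackInner : ContDiff ℝ ∞ (pullbackInner : (E →L[ℝ] F) → E →L[ℝ] E →L[ℝ] ℝ) := by
  unfold pullbackInner
  fun_prop

/-- The scalar product on `T_pG` that corresponds under left translation to the scalar product on
`𝔤` given by a linear isomorphism `T` of `𝔤` with an inner product space. -/
def leftInvariantForm (T : E ≃L[ℝ] F) (p : G) :
    TangentSpace I p →L[ℝ] TangentSpace I p →L[ℝ] ℝ :=
  (pullbackInner ((T : E →L[ℝ] F) ∘L leftTrivialization I p) : E →L[ℝ] E →L[ℝ] ℝ)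

lemma leftInvariantForm_apply (T : E ≃L[ℝ] F) (p : G) (v w : TangentSpace I p) :
    leftInvariantForm T p v w
      = inner ℝ (T (leftTrivialization I p v)) (T (leftTrivialization I p w)) := rfl

variable [LieGroup I ∞ G]

/-- Near `p₀` the trivialized form is the pull-back of the inner product along a linear map
depending smoothly on `p`, and the pull-back is quadratic in that map. -/
lemma contMDiff_leftInvariantForm (T : E ≃L[ℝ] F) :
    ContMDiff I (I.prod 𝓘(ℝ, E →L[ℝ] E →L[ℝ] ℝ)) ∞
      (fun p : G => TotalSpace.mk' (E →L[ℝ] E →L[ℝ] ℝ)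
        (E := fun p : G => TangentSpace I p →L[ℝ] TangentSpace I p →L[ℝ] ℝ) p
        (leftInvariantForm T p)) := by
  intro p₀
  rw [contMDiffAt_section]
  have h : ContMDiffAt I 𝓘(ℝ, E →L[ℝ] E →L[ℝ] ℝ) ∞ (fun p : G => pullbackInner
      ((T : E →L[ℝ] F) ∘L (leftTrivialization I p ∘L
        (tangentBundleCore I G).coordChange (achart H p₀) (achart H p) p))) p₀ :=
    contDiff_pullbackInner.contDiffAt.comp_contMDiffAt
      (contMDiffAt_const.clm_comp (contMDiffAt_leftTrivialization p₀))
  refine h.congr_of_eventuallyEq ?_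
  filter_upwards [chart_source_mem_nhds H p₀] with p hp
  ext v w
  have hs (u : E) : (trivializationAt E (TangentSpace I) p₀).symm p u
      = (tangentBundleCore I G).coordChange (achart H p₀) (achart H p) p u := by
    exact ((trivializationAt E (TangentSpace I) p₀).symmL_apply (by simpa using hp) u).symm.trans
      (DFunLike.congr_fun (TangentBundle.symmL_trivializationAt_eq_core (I := I) hp) u)
  rw [hom_trivializationAt_apply,
    inCoordinates_apply_eq₂ (by simpa using hp) (by simpa using hp) (Set.mem_univ _), hs, hs]
  exact DFunLike.congr_fun (Trivial.linearMapAt_trivialization ℝ G ℝ p) _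

variable (G) in
/-- The left-invariant Riemannian metric on a Lie group whose value at `1` is the scalar product
given by a linear isomorphism `T` of `𝔤` with an inner product space. -/
def leftInvariantMetric (T : E ≃L[ℝ] F) : RiemannianMetricOn I G where
  inner p := leftInvariantForm T p
  symm p v w := by
    rw [leftInvariantForm_apply, leftInvariantForm_apply, real_inner_comm]
  pos p v hv := by
    rw [leftInvariantForm_apply]
    refine real_inner_self_pos.2 ?_
    intro h
    apply hv
    apply (T.injective.comp (leftTrivialization_injective (I := I) p))
    exact h.trans (((T : E →L[ℝ] F) ∘L leftTrivialization I p).map_zero).symm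
  isVonNBounded p := by
    have hb : Bornology.IsVonNBounded ℝ (Metric.ball (0 : F) 1) :=
      NormedSpace.isVonNBounded_ball ℝ F 1
    let D : E →L[ℝ] E := mfderiv I I (fun x : G => p * x) (1 : G)
    -- The unit ball at `p` lies in the image of the unit ball of `F` under `dL_p ∘ T⁻¹`.
    refine (hb.image (D ∘L (T.symm : F →L[ℝ] E))).subset ?_
    intro v hv
    have hv' : inner ℝ (T (leftTrivialization I p v)) (T (leftTrivialization I p v)) < 1 := hv
    rw [real_inner_self_eq_norm_sq] at hv'
    refine ⟨T (leftTrivialization I p v), ?_, ?_⟩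
    · rw [mem_ball_zero_iff]
      nlinarith [norm_nonneg (T (leftTrivialization I p v))]
    · exact (congrArg D (T.symm_apply_apply _)).trans (mfderiv_mul_left_leftTrivialization p v)
  contMDiff := contMDiff_leftInvariantForm T

lemma leftInvariantMetric_isLeftInvariant (T : E ≃L[ℝ] F) :
    (leftInvariantMetric (I := I) G T).IsLeftInvariant := by
  intro p q v w
  change leftInvariantForm T (p * q) _ _ = leftInvariantForm T q v w
  simp only [leftInvariantForm_apply]
  rw [leftTrivialization_mul_mfderiv, leftTrivialization_mul_mfderiv]

end Metric

/-! ### Lipschitz functions for the Riemannian distance -/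

section Distance

variable {E : Type*} [NormedAddCommGroup E] [NormedSpace ℝ E]
  {F : Type*} [NormedAddCommGroup F] [InnerProductSpace ℝ F]
  {V : Type*} [NormedAddCommGroup V] [NormedSpace ℝ V]
  {H : Type*} [TopologicalSpace H] {I : ModelWithCorners ℝ E H}
  {G : Type*} [TopologicalSpace G] [ChartedSpace H G] [Group G] [LieGroup I ∞ G]

/-- If a map `f` from a Lie group to a normed space is Lipschitz infinitesimally for a
left-invariant metric, then it is Lipschitz for the Riemannian distance. -/
lemma enorm_sub_le_mul_distOne [CompleteSpace V] (T : E ≃L[ℝ] F) {f : G → V}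
    (hf : ContMDiff I 𝓘(ℝ, V) 1 f) {f' : G → E →L[ℝ] V}
    (hf' : ∀ p, mfderiv I 𝓘(ℝ, V) f p = f' p) {C : ℝ≥0} (hC0 : C ≠ 0)
    (hC : ∀ (p : G) (v : E), ‖f' p v‖ ≤ C * ‖T (leftTrivialization I p v)‖) (p : G) :
    ‖f p - f 1‖ₑ ≤ C * (leftInvariantMetric (I := I) G T).distOne p := by
  let _ : RiemannianBundle (fun x : G => TangentSpace I x) :=
    ⟨(leftInvariantMetric (I := I) G T).toRiemannianMetric⟩
  change ‖f p - f 1‖ₑ ≤ C * Manifold.riemannianEDist I (1 : G) p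
  have hnorm (q : G) (v : TangentSpace I q) : ‖v‖ = ‖T (leftTrivialization I q v)‖ := by
    rw [norm_eq_sqrt_real_inner (F := TangentSpace I q), norm_eq_sqrt_real_inner (F := F)]
    rfl
  have hlen (γ : ℝ → G) (h0 : γ 0 = 1) (h1 : γ 1 = p)
      (hγ : ContMDiffOn 𝓘(ℝ, ℝ) I 1 γ (Icc 0 1)) :
      ‖f p - f 1‖ₑ ≤ C * Manifold.pathELength I γ 0 1 := by
    have hD : ContDiffOn ℝ 1 (f ∘ γ) (Icc 0 1) :=
      contMDiffOn_iff_contDiffOn.mp (hf.comp_contMDiffOn hγ)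
    have h := enorm_sub_le_lintegral_derivWithin_Icc_of_contDiffOn_Icc hD zero_le_one
    rw [Function.comp_apply, Function.comp_apply, h0, h1] at h
    refine h.trans ?_
    rw [Manifold.pathELength_eq_lintegral_mfderivWithin_Icc,
      ← lintegral_const_mul' _ _ ENNReal.coe_ne_top]
    refine setLIntegral_mono' measurableSet_Icc fun t ht => ?_
    have hu : UniqueMDiffWithinAt 𝓘(ℝ, ℝ) (Icc (0 : ℝ) 1) t :=
      (uniqueDiffOn_Icc zero_lt_one _ ht).uniqueMDiffWithinAt
    have hc := mfderiv_comp_mfderivWithin t (hf.mdifferentiable one_ne_zero (γ t))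
      (hγ.mdifferentiableOn one_ne_zero t ht) hu
    rw [mfderivWithin_eq_fderivWithin] at hc
    have hd : derivWithin (f ∘ γ) (Icc 0 1) t = f' (γ t)
        (mfderivWithin 𝓘(ℝ, ℝ) I γ (Icc 0 1) t (1 : ℝ)) := by
      rw [← fderivWithin_derivWithin, ← hf']
      exact DFunLike.congr_fun hc (1 : ℝ)
    have hb := hC (γ t) (mfderivWithin 𝓘(ℝ, ℝ) I γ (Icc 0 1) t (1 : ℝ))
    rw [← hd, ← hnorm] at hb
    rw [← ofReal_norm, ← ofReal_norm]
    refine (ENNReal.ofReal_le_ofReal hb).trans ?_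
    rw [ENNReal.ofReal_mul C.coe_nonneg, ENNReal.ofReal_coe_nnreal]
    exact le_rfl
  have hC0' : (C : ℝ≥0∞) ≠ 0 := by simpa using hC0
  -- Dividing by `C ≠ 0` isolates the infimum, which is then approached by lengths of curves.
  rw [mul_comm, ← ENNReal.div_le_iff_le_mul (Or.inl hC0') (Or.inl ENNReal.coe_ne_top)]
  refine le_of_forall_gt fun r hr => ?_
  obtain ⟨γ, h0, h1, hγ, hlt⟩ := Manifold.exists_lt_of_riemannianEDist_lt hr
  refine lt_of_le_of_lt ?_ hlt
  rw [ENNReal.div_le_iff_le_mul (Or.inl hC0') (Or.inl ENNReal.coe_ne_top), mul_comm]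
  exact hlen γ h0 h1 hγ

end Distance

/-! ### The adjoint representation and its boundedness on pseudo-compact groups -/

section Adjoint

variable {E : Type*} [NormedAddCommGroup E] [NormedSpace ℝ E]
  {H : Type*} [TopologicalSpace H] {I : ModelWithCorners ℝ E H}
  {G : Type*} [TopologicalSpace G] [ChartedSpace H G] [Group G]

variable (I) in
/-- The adjoint representation with values in the endomorphisms of the model space. -/
def adjointCLM (p : G) : E →L[ℝ] E := lieAd I p

lemma adjointCLM_eq_mfderiv (p : G) :
    adjointCLM I p = (mfderiv I I (fun q : G => p * q * p⁻¹) 1 : E →L[ℝ] E) := rfl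

lemma adjointCLM_one : adjointCLM I (1 : G) = ContinuousLinearMap.id ℝ E := by
  have h : (fun x : G => 1 * x * 1⁻¹) = id := by funext x; simp
  rw [adjointCLM_eq_mfderiv, h]
  exact mfderiv_id

variable [LieGroup I ∞ G]

lemma contMDiff_conj (p : G) : ContMDiff I I ∞ (fun q : G => p * q * p⁻¹) :=
  contMDiff_mul_right.comp contMDiff_mul_left

lemma adjointCLM_mul (p q : G) : adjointCLM I (p * q) = adjointCLM I p ∘L adjointCLM I q := by
  have h : (fun x : G => p * q * x * (p * q)⁻¹)
      = (fun x : G => p * x * p⁻¹) ∘ (fun x : G => q * x * q⁻¹) := by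
    funext x; simp [mul_assoc]
  have hd (p q : G) : MDifferentiableAt I I (fun x : G => p * x * p⁻¹) q :=
    (contMDiff_conj p).mdifferentiable (by simp) q
  have h2 := mfderiv_comp (I := I) (I' := I) (I'' := I) (1 : G) (hd p _) (hd q 1)
  rw [← h] at h2
  refine Eq.trans h2 ?_
  have h3 : (mfderiv I I (fun x : G => p * x * p⁻¹) (q * 1 * q⁻¹) : E →L[ℝ] E)
      = adjointCLM I p := by
    rw [show q * 1 * q⁻¹ = 1 by group]; rfl
  exact congrArg (fun A : E →L[ℝ] E => A ∘L adjointCLM I q) h3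

/-- Conjugation is jointly smooth and fixes `1`, so its differential at `1` varies smoothly with
`p`; continuity suffices for a bound over a compact factor. -/
lemma continuous_adjointCLM : Continuous (adjointCLM I : G → E →L[ℝ] E) := by
  refine continuous_iff_continuousAt.2 fun p₀ => ?_
  have hf : ContMDiffAt (I.prod I) I ∞ (Function.uncurry fun p x : G => p * x * p⁻¹)
      (p₀, (1 : G)) :=
    ((contMDiff_fst.mul contMDiff_snd).mul contMDiff_fst.inv).contMDiffAt
  have h := ContMDiffAt.mfderiv (n := ∞) (m := ∞) (fun p x : G => p * x * p⁻¹)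
    (fun _ => (1 : G)) hf contMDiffAt_const (by simp)
  have h1 : (fun x : G => x * 1 * x⁻¹) = fun _ => 1 := by funext x; simp
  change ContMDiffAt I 𝓘(ℝ, E →L[ℝ] E) ∞
    (inTangentCoordinates I I (fun _ : G => (1 : G)) (fun x : G => x * 1 * x⁻¹)
      (fun p : G => adjointCLM I p) p₀) p₀ at h
  rw [h1] at h
  refine h.continuousAt.congr (Eventually.of_forall fun p => ?_)
  refine (inTangentCoordinates_eq (I := I) (I' := I) (fun _ : G => (1 : G)) (fun _ : G => (1 : G))
    (fun p : G => adjointCLM I p) (mem_chart_source H _) (mem_chart_source H _)).trans ?_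
  ext v
  have hs := (tangentBundleCore I G).coordChange_self (achart H (1 : G)) 1 (mem_chart_source H _)
  exact (hs _).trans (congrArg (adjointCLM I p) (hs v))

/-- The adjoint representation of a pseudo-compact Lie group is bounded. -/
lemma IsPseudoCompact.exists_norm_adjointCLM_le {K : Type*} [TopologicalSpace K]
    [ChartedSpace H K] [Group K] [LieGroup I ∞ K] (hK : IsPseudoCompact I K) :
    ∃ C : ℝ, ∀ k : K, ‖adjointCLM I k‖ ≤ C := by
  obtain ⟨m, n, C, _, _, _, _, _, e, he⟩ := hK
  have hcont : Continuous fun c : C => ‖adjointCLM I (e.symm (c, 0))‖ :=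
    (continuous_adjointCLM.comp (e.symm.continuous.comp (Continuous.prodMk_left 0))).norm
  obtain ⟨A, hA⟩ := (isCompact_range hcont).bddAbove
  refine ⟨A, fun k => ?_⟩
  refine le_trans (le_of_eq ?_) (hA ⟨(e k).1, rfl⟩)
  -- The vector factor is abelian and commutes with `C`, hence is central in `K` and acts trivially
  -- under `Ad`.
  have hcomm (z x : K) (hz : (e z).1 = 1) : z * x = x * z := by
    refine e.injective (?_ : e (z * x) = e (x * z))
    rw [he, he, hz, add_comm, one_mul, mul_one]
  have hk : k = e.symm ((1 : C), (e k).2) * e.symm ((e k).1, 0) := by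
    refine e.injective (?_ : e k = e (_ * _))
    rw [he]; simp
  have h1 : adjointCLM I (e.symm ((1 : C), (e k).2)) = ContinuousLinearMap.id ℝ E := by
    rw [← adjointCLM_one (I := I) (G := K), adjointCLM_eq_mfderiv, adjointCLM_eq_mfderiv]
    congr 1
    funext x
    rw [hcomm _ x (by simp)]; simp
  have h2 : adjointCLM I k = adjointCLM I (e.symm ((1 : C), (e k).2) * e.symm ((e k).1, 0)) :=
    congrArg _ hk
  rw [h2, adjointCLM_mul, h1]
  rfl

end Adjoint

/-! ### A criterion for linear growth -/

section LinearGrowth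

variable {E : Type*} [NormedAddCommGroup E] [NormedSpace ℝ E]
  {F : Type*} [NormedAddCommGroup F] [InnerProductSpace ℝ F]
  {H : Type*} [TopologicalSpace H] {I : ModelWithCorners ℝ E H}
  {G : Type*} [TopologicalSpace G] [ChartedSpace H G] [Group G]

variable (I G) in
/-- The scalar product on the Lie algebra given by a linear isomorphism `T` of `𝔤` with an inner
product space. -/
def lieAlgebraScalarProductOfEquiv (T : E ≃L[ℝ] F) : LieAlgebraScalarProduct I G where
  form := (LinearMap.mk₂ ℝ (fun u v : E => inner ℝ (T u) (T v))
    (fun _ _ _ => by rw [map_add, inner_add_left])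
    (fun _ _ _ => by rw [map_smul, real_inner_smul_left, smul_eq_mul])
    (fun _ _ _ => by rw [map_add, inner_add_right])
    (fun _ _ _ => by rw [map_smul, real_inner_smul_right, smul_eq_mul]) : E →ₗ[ℝ] E →ₗ[ℝ] ℝ)
  symm _ _ := real_inner_comm (F := F) _ _
  pos u hu := real_inner_self_pos.2 fun h : T (show E from u) = 0 =>
    hu ((map_eq_zero_iff T T.injective).1 h)

lemma lieAlgebraScalarProductOfEquiv_enorm (T : E ≃L[ℝ] F) (u : E) :
    (lieAlgebraScalarProductOfEquiv I G T).enorm u = ‖T u‖ₑ := by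
  rw [← ofReal_norm, norm_eq_sqrt_real_inner]
  rfl

variable [LieGroup I ∞ G]

/-- A Lie group has linear growth if the adjoint representation is bounded, in both directions, by
an affine function of a function that grows at most linearly in the distance from `1`. -/
lemma hasLinearGrowth_of_norm_adjointCLM_le (T : E ≃L[ℝ] F) (φ : G → ℝ≥0) (a b c : ℝ≥0)
    (hφ : ∀ p, (φ p : ℝ≥0∞) ≤ c * (leftInvariantMetric (I := I) G T).distOne p)
    (h : ∀ p u, ‖T (adjointCLM I p u)‖ ≤ (a + b * φ p) * ‖T u‖)
    (h' : ∀ p u, ‖T (adjointCLM I p⁻¹ u)‖ ≤ (a + b * φ p) * ‖T u‖) :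
    HasLinearGrowth I G := by
  refine ⟨leftInvariantMetric G T, leftInvariantMetric_isLeftInvariant T,
    lieAlgebraScalarProductOfEquiv I G T, a, b * c, fun p => ?_⟩
  have hbound : (a : ℝ≥0∞) + b * φ p
      ≤ a + (b * c : ℝ≥0) * (leftInvariantMetric (I := I) G T).distOne p := by
    rw [ENNReal.coe_mul, mul_assoc]
    gcongr
    exact hφ p
  have key (q : G) (hq : ∀ u, ‖T (adjointCLM I q u)‖ ≤ (a + b * φ p) * ‖T u‖) (u : E) :
      ‖T (adjointCLM I q u)‖ₑ
        ≤ (a + (b * c : ℝ≥0) * (leftInvariantMetric (I := I) G T).distOne p) * ‖T u‖ₑ := by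
    refine le_trans ?_ (mul_le_mul_left hbound _)
    have := hq u
    rw [enorm_eq_nnnorm, enorm_eq_nnnorm]
    exact_mod_cast this
  intro (u : E)
  change (lieAlgebraScalarProductOfEquiv I G T).enorm u / _
    ≤ (lieAlgebraScalarProductOfEquiv I G T).enorm (adjointCLM I p u) ∧
    (lieAlgebraScalarProductOfEquiv I G T).enorm (adjointCLM I p u)
      ≤ _ * (lieAlgebraScalarProductOfEquiv I G T).enorm u
  rw [lieAlgebraScalarProductOfEquiv_enorm, lieAlgebraScalarProductOfEquiv_enorm]
  refine ⟨ENNReal.div_le_of_le_mul ?_, key p (h p) u⟩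
  -- The lower bound comes from applying the estimate for `p⁻¹` to `Ad_p u`.
  have hu : adjointCLM I p⁻¹ (adjointCLM I p u) = u := by
    rw [← ContinuousLinearMap.comp_apply, ← adjointCLM_mul, inv_mul_cancel, adjointCLM_one]
    rfl
  have h1 := key p⁻¹ (h' p) (adjointCLM I p u)
  rwa [hu, mul_comm] at h1

end LinearGrowth

/-! ### Adjoint action and left translations of the semidirect product -/

section Semidirect

variable {E : Type*} [NormedAddCommGroup E] [NormedSpace ℝ E]
  {H : Type*} [TopologicalSpace H] {I : ModelWithCorners ℝ E H}
  {K : Type*} [TopologicalSpace K] [ChartedSpace H K] [Group K]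
  {V : Type*} [NormedAddCommGroup V] [NormedSpace ℝ V] [FiniteDimensional ℝ V]

namespace LieSemidirect

variable (ρ : ContMDiffMonoidMorphism I 𝓘(ℝ, V →L[ℝ] V) ∞ K (V →L[ℝ] V)ˣ)

lemma contMDiff_rep : ContMDiff I 𝓘(ℝ, V →L[ℝ] V) ∞ (fun k : K => (ρ k : V →L[ℝ] V)) :=
  Units.contMDiff_val.comp ρ.contMDiff_toFun

/-- The derivative `𝔨 → 𝔤𝔩(V)` of a representation `ρ : K → GL(V)`. -/
def lieRep : E →L[ℝ] V →L[ℝ] V :=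
  mfderiv I 𝓘(ℝ, V →L[ℝ] V) (fun k : K => (ρ k : V →L[ℝ] V)) 1

variable [LieGroup I ∞ K]

/-- This supplies the term `dρ(Ad_k X) v`, the only one in `Ad_p` that involves `v`. -/
lemma hasMFDerivAt_rep_conj_apply (k : K) (v : V) :
    HasMFDerivAt I 𝓘(ℝ, V) (fun h : K => (ρ (k * h * k⁻¹) : V →L[ℝ] V) v) 1
      (((lieRep ρ).flip v) ∘L adjointCLM I k : E →L[ℝ] V) := by
  have h1 : HasMFDerivAt I I (fun h : K => k * h * k⁻¹) 1 (adjointCLM I k : E →L[ℝ] E) :=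
    ((contMDiff_conj (I := I) k).mdifferentiable (by simp) 1).hasMFDerivAt
  have h2 : HasMFDerivAt I 𝓘(ℝ, V →L[ℝ] V) (fun k : K => (ρ k : V →L[ℝ] V)) (k * 1 * k⁻¹)
      (lieRep ρ : E →L[ℝ] V →L[ℝ] V) := by
    rw [show k * 1 * k⁻¹ = 1 by group]
    exact ((contMDiff_rep ρ).mdifferentiable (by simp) 1).hasMFDerivAt
  have h3 := (ContinuousLinearMap.apply ℝ V v).hasMFDerivAt (x := (ρ (k * 1 * k⁻¹) : V →L[ℝ] V))
  exact HasMFDerivAt.comp (1 : K) h3 (HasMFDerivAt.comp (1 : K) h2 h1)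

lemma adjointCLM_apply (p : LieSemidirect ρ) (u : E × V) :
    adjointCLM (I.prod 𝓘(ℝ, V)) p u = (adjointCLM I p.1 u.1,
      (ρ p.1 : V →L[ℝ] V) u.2 - lieRep ρ (adjointCLM I p.1 u.1) p.2) := by
  have hfst : HasMFDerivAt (I.prod 𝓘(ℝ, V)) I (Prod.fst : K × V → K) (1, 0)
    (ContinuousLinearMap.fst ℝ E V) :=
    hasMFDerivAt_fst _
  have hsnd : HasMFDerivAt (I.prod 𝓘(ℝ, V)) 𝓘(ℝ, V) (Prod.snd : K × V → V) (1, 0)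
    (ContinuousLinearMap.snd ℝ E V) :=
    hasMFDerivAt_snd _
  have h1 : HasMFDerivAt I I (fun h : K => p.1 * h * p.1⁻¹) 1 (adjointCLM I p.1 : E →L[ℝ] E) :=
    ((contMDiff_conj (I := I) p.1).mdifferentiable (by simp) 1).hasMFDerivAt
  have h2 := hasMFDerivAt_rep_conj_apply ρ p.1 p.2
  have h3 := (ρ p.1 : V →L[ℝ] V).hasMFDerivAt (x := 0)
  have h1' := HasMFDerivAt.comp ((1, 0) : K × V) h1 hfst
  have h2' := HasMFDerivAt.comp ((1, 0) : K × V) h2 hfst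
  have h3' := HasMFDerivAt.comp ((1, 0) : K × V) h3 hsnd
  have h4 := h1'.prodMk (((hasMFDerivAt_const p.2 _).add h3').sub h2')
  have hconj : (fun q : LieSemidirect ρ => p * q * p⁻¹) = fun q : K × V =>
      (p.1 * q.1 * p.1⁻¹, p.2 + (ρ p.1 : V →L[ℝ] V) q.2
        - (ρ (p.1 * q.1 * p.1⁻¹) : V →L[ℝ] V) p.2) := by
    funext q
    refine Prod.ext rfl ?_
    change p.2 + (ρ p.1 : V →L[ℝ] V) q.2
      + (ρ (p.1 * q.1) : V →L[ℝ] V) (-(ρ p.1⁻¹ : V →L[ℝ] V) p.2) = _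
    simp [map_mul, sub_eq_add_neg]
  have h5 : HasMFDerivAt (I.prod 𝓘(ℝ, V)) (I.prod 𝓘(ℝ, V))
      (fun q : LieSemidirect ρ => p * q * p⁻¹) 1
      ((adjointCLM I p.1 ∘L ContinuousLinearMap.fst ℝ E V).prod
        (0 + (ρ p.1 : V →L[ℝ] V) ∘L ContinuousLinearMap.snd ℝ E V -
          ((lieRep ρ).flip p.2 ∘L adjointCLM I p.1) ∘L ContinuousLinearMap.fst ℝ E V) :
        E × V →L[ℝ] E × V) := by
    rw [hconj]
    exact h4
  refine (DFunLike.congr_fun h5.mfderiv u).trans ?_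
  refine Prod.ext rfl ?_
  change (0 : V) + (ρ p.1 : V →L[ℝ] V) u.2 - lieRep ρ (adjointCLM I p.1 u.1) p.2 = _
  rw [zero_add]

/-- The `V`-component of `p * q` is `p.2 + ρ(p.1) q.2`, so `dL_p` acts by `ρ(p.1)` on that
component. A bound on `ρ` thus makes the projection to `V` Lipschitz. -/
lemma snd_leftTrivialization (p : LieSemidirect ρ) (u : E × V) :
    (ρ p.1 : V →L[ℝ] V) (leftTrivialization (I.prod 𝓘(ℝ, V)) p u).2 = u.2 := by
  let D : E × V →L[ℝ] E × V :=
    mfderiv (I.prod 𝓘(ℝ, V)) (I.prod 𝓘(ℝ, V)) (fun q : LieSemidirect ρ => p * q) 1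
  have hD : HasMFDerivAt (I.prod 𝓘(ℝ, V)) (I.prod 𝓘(ℝ, V))
      (fun q : LieSemidirect ρ => p * q) 1 D := (mdifferentiable_mul_left' p 1).hasMFDerivAt
  have h1 : HasMFDerivAt (I.prod 𝓘(ℝ, V)) 𝓘(ℝ, V) (Prod.snd : K × V → V) (p * 1)
      (ContinuousLinearMap.snd ℝ E V) := hasMFDerivAt_snd _
  have h2 : HasMFDerivAt (I.prod 𝓘(ℝ, V)) 𝓘(ℝ, V)
      (fun q : LieSemidirect ρ => (p * q).2) 1 (ContinuousLinearMap.snd ℝ E V ∘L D) :=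
    HasMFDerivAt.comp (M := K × V) (M' := K × V) ((1, 0) : K × V)
      (f := fun q : K × V => (p * (show LieSemidirect ρ from q) : LieSemidirect ρ)) h1 hD
  have hsnd : HasMFDerivAt (I.prod 𝓘(ℝ, V)) 𝓘(ℝ, V) (Prod.snd : K × V → V) (1, 0)
      (ContinuousLinearMap.snd ℝ E V) := hasMFDerivAt_snd _
  have h3 := (ρ p.1 : V →L[ℝ] V).hasMFDerivAt (x := 0)
  have h4 := (hasMFDerivAt_const p.2 _).add (HasMFDerivAt.comp ((1, 0) : K × V) h3 hsnd)
  have h5 : HasMFDerivAt (I.prod 𝓘(ℝ, V)) 𝓘(ℝ, V) (fun q : LieSemidirect ρ => (p * q).2) 1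
    (0 + (ρ p.1 : V →L[ℝ] V) ∘L ContinuousLinearMap.snd ℝ E V : E × V →L[ℝ] V) := h4
  have h6 : ContinuousLinearMap.snd ℝ E V ∘L D
      = 0 + (ρ p.1 : V →L[ℝ] V) ∘L ContinuousLinearMap.snd ℝ E V :=
    h2.mfderiv.symm.trans h5.mfderiv
  have h7 : D (leftTrivialization (I.prod 𝓘(ℝ, V)) p u) = u :=
    mfderiv_mul_left_leftTrivialization p u
  have h8 := DFunLike.congr_fun h6 (leftTrivialization (I.prod 𝓘(ℝ, V)) p u)
  simp only [ContinuousLinearMap.comp_apply, h7, zero_add] at h8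
  exact h8.symm

end LieSemidirect

end Semidirect

end

/-! ### Norm bounds for a bounded representation -/

section BoundedRepresentation

variable {E : Type*} [NormedAddCommGroup E] [NormedSpace ℝ E]
  {H : Type*} [TopologicalSpace H] {I : ModelWithCorners ℝ E H}
  {K : Type*} [TopologicalSpace K] [ChartedSpace H K] [Group K]
  {V : Type*} [NormedAddCommGroup V] [NormedSpace ℝ V] [FiniteDimensional ℝ V]

namespace LieSemidirect

variable (ρ : ContMDiffMonoidMorphism I 𝓘(ℝ, V →L[ℝ] V) ∞ K (V →L[ℝ] V)ˣ)

lemma exists_norm_rep_le (hρ : IsCompact (closure (Set.range ρ))) :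
    ∃ M : ℝ, ∀ k : K, ‖(ρ k : V →L[ℝ] V)‖ ≤ M := by
  obtain ⟨M, hM⟩ := (hρ.image (Units.continuous_val.norm)).bddAbove
  exact ⟨M, fun k => hM ⟨ρ k, subset_closure ⟨k, rfl⟩, rfl⟩⟩

variable [LieGroup I ∞ K]

lemma norm_adjointCLM_apply_le {A M : ℝ} (hA : ∀ k : K, ‖adjointCLM I k‖ ≤ A)
    (hM : ∀ k : K, ‖(ρ k : V →L[ℝ] V)‖ ≤ M) (p : LieSemidirect ρ) (u : E × V) :
    ‖adjointCLM (I.prod 𝓘(ℝ, V)) p u‖ ≤ (A + M + ‖lieRep ρ‖ * A * ‖p.2‖) * ‖u‖ := by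
  have hA0 : 0 ≤ A := (norm_nonneg _).trans (hA 1)
  have hM0 : 0 ≤ M := (norm_nonneg _).trans (hM 1)
  have h1 : ‖adjointCLM I p.1 u.1‖ ≤ A * ‖u‖ :=
    ((adjointCLM I p.1).le_of_opNorm_le (hA _) _).trans (by gcongr; exact norm_fst_le u)
  have h2 : ‖(ρ p.1 : V →L[ℝ] V) u.2‖ ≤ M * ‖u‖ :=
    ((ρ p.1 : V →L[ℝ] V).le_of_opNorm_le (hM _) _).trans (by gcongr; exact norm_snd_le u)
  have h3 : ‖lieRep ρ (adjointCLM I p.1 u.1) p.2‖ ≤ ‖lieRep ρ‖ * (A * ‖u‖) * ‖p.2‖ :=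
    ((lieRep ρ).le_opNorm₂ _ _).trans (by gcongr)
  have h4 : 0 ≤ ‖lieRep ρ‖ * A * ‖p.2‖ * ‖u‖ := by positivity
  have h5 : 0 ≤ A * ‖u‖ := by positivity
  have h6 : 0 ≤ M * ‖u‖ := by positivity
  rw [adjointCLM_apply, Prod.norm_mk]
  refine max_le ?_ ((norm_sub_le _ _).trans ?_) <;> nlinarith

end LieSemidirect

end BoundedRepresentation

/-! ### Linear growth of the semidirect product -/

theorem proposition5
    {E : Type*} [NormedAddCommGroup E] [NormedSpace ℝ E] [FiniteDimensional ℝ E]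
    {H : Type*} [TopologicalSpace H] (I : ModelWithCorners ℝ E H) [I.Boundaryless]
    {K : Type*} [TopologicalSpace K] [ChartedSpace H K] [Group K] [LieGroup I ∞ K]
    {V : Type*} [NormedAddCommGroup V] [NormedSpace ℝ V] [FiniteDimensional ℝ V]
    (hK : IsPseudoCompact I K)
    (ρ : ContMDiffMonoidMorphism I 𝓘(ℝ, V →L[ℝ] V) ∞ K (V →L[ℝ] V)ˣ)
    (hρ : IsCompact (closure (Set.range ρ))) :
    HasLinearGrowth (I.prod 𝓘(ℝ, V)) (LieSemidirect ρ) := by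
  obtain ⟨A, hA⟩ := hK.exists_norm_adjointCLM_le
  obtain ⟨M, hM⟩ := LieSemidirect.exists_norm_rep_le ρ hρ
  have hA0 : 0 ≤ A := (norm_nonneg _).trans (hA 1)
  have hM0 : 0 ≤ M := (norm_nonneg _).trans (hM 1)
  -- The sup norm on `E × V` need not be Euclidean; passing through `T` costs the factor `S = ‖T₁‖ *
  -- ‖T₂‖`.
  let T : (E × V) ≃L[ℝ] EuclideanSpace ℝ (Fin (Module.finrank ℝ (E × V))) :=
    toEuclidean
  let T₁ : E × V →L[ℝ] EuclideanSpace ℝ (Fin (Module.finrank ℝ (E × V))) := T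
  let T₂ : EuclideanSpace ℝ (Fin (Module.finrank ℝ (E × V))) →L[ℝ] E × V := T.symm
  have hT₂ (u : E × V) : ‖u‖ ≤ ‖T₂‖ * ‖T u‖ := by
    simpa [T₂] using T₂.le_opNorm (T u)
  let S : ℝ := ‖T₁‖ * ‖T₂‖
  -- The factor `M + 1` allows both `q = p` and `q = p⁻¹`, whose `V`-components are bounded by
  -- `‖p.2‖` and `M * ‖p.2‖`.
  have hT (p q : LieSemidirect ρ) (hq : ‖q.2‖ ≤ (M + 1) * ‖p.2‖) (u : E × V) :
      ‖T (adjointCLM (I.prod 𝓘(ℝ, V)) q u)‖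
        ≤ (S * (A + M) + S * (‖LieSemidirect.lieRep ρ‖ * A * (M + 1)) * ‖p.2‖) * ‖T u‖ := by
    calc ‖T (adjointCLM (I.prod 𝓘(ℝ, V)) q u)‖
        ≤ ‖T₁‖ * ‖adjointCLM (I.prod 𝓘(ℝ, V)) q u‖ :=
          T₁.le_opNorm _
      _ ≤ ‖T₁‖ * ((A + M + ‖LieSemidirect.lieRep ρ‖ * A * ((M + 1) * ‖p.2‖)) *
          (‖T₂‖ * ‖T u‖)) := by
        gcongr
        refine (LieSemidirect.norm_adjointCLM_apply_le ρ hA hM q u).trans ?_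
        gcongr
        exact hT₂ u
      _ = _ := by simp only [S]; ring
  refine hasLinearGrowth_of_norm_adjointCLM_le T (fun p => ‖p.2‖₊) ⟨S * (A + M), by positivity⟩
    ⟨S * (‖LieSemidirect.lieRep ρ‖ * A * (M + 1)), by positivity⟩
    -- `M * ‖T₂‖` already bounds the derivative of the projection to `V`; the `1` makes the constant
    -- nonzero.
    ⟨M * ‖T₂‖ + 1, by positivity⟩ (fun p => ?_)
    (fun p u => hT p p ?_ u) (fun p u => hT p p⁻¹ ?_ u)
  · have hsnd : ContMDiff (I.prod 𝓘(ℝ, V)) 𝓘(ℝ, V) 1 (fun q : LieSemidirect ρ => q.2) :=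
      contMDiff_snd (I := I) (J := 𝓘(ℝ, V)) (M := K) (N := V)
    have h := enorm_sub_le_mul_distOne T hsnd (f' := fun _ => ContinuousLinearMap.snd ℝ E V)
      (fun q => (hasMFDerivAt_snd (I := I) (I' := 𝓘(ℝ, V)) (M := K) (M' := V) q).mfderiv)
      (C := ⟨M * ‖T₂‖ + 1, by positivity⟩) ?_ ?_ p
    · change ‖p.2 - 0‖ₑ ≤ _ at h
      rwa [sub_zero] at h
    · exact fun h => (by positivity : (0 : ℝ) < M * ‖T₂‖ + 1).ne' (congrArg NNReal.toReal h)
    · intro q u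
      rw [ContinuousLinearMap.coe_snd', ← LieSemidirect.snd_leftTrivialization ρ q u]
      set w := leftTrivialization (I.prod 𝓘(ℝ, V)) q u
      calc ‖(ρ q.1 : V →L[ℝ] V) w.2‖ ≤ M * ‖w.2‖ := (ρ q.1 : V →L[ℝ] V).le_of_opNorm_le (hM _) _
        _ ≤ M * (‖T₂‖ * ‖T w‖) := by
          gcongr
          exact (norm_snd_le w).trans (hT₂ w)
        _ ≤ (M * ‖T₂‖ + 1) * ‖T w‖ := by
          nlinarith [norm_nonneg (T w)]
  · nlinarith [norm_nonneg p.2]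
  · change ‖-(ρ p.1⁻¹ : V →L[ℝ] V) p.2‖ ≤ _
    rw [norm_neg]
    refine ((ρ p.1⁻¹ : V →L[ℝ] V).le_of_opNorm_le (hM _) _).trans ?_
    nlinarith [norm_nonneg p.2]
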